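/- Fix an integer $K\ge 1$ and let $n$ range over the positive multiples of $K$. Let $\mathcal Z_{n,K}=[K]^n$ be the set of assignments of $n$ nodes to $K$ communities. For a permutation $\delta$ of $[K]$ put $(\delta\circ z)_i=\delta(z_i)$, let $\langle z\rangle=\{\delta\circ z:\delta \text{ a permutation of }[K]\}$, and let $d(z,z')=\min_\delta \#\{i:\delta(z_i)\ne z'_i\}$. For each $n$ let $z_0=z_0^{(n)}\in\mathcal Z_{n,K}$, let $p_0=p_0^{(n)}\ne q_0=q_0^{(n)}$ be numbers in $[0,1]$, and let $\Pi=\Pi^{(n)}$ be a prior probability distribution on $\mathcal Z_{n,K}$. Put $$\bar D(p_0,q_0)=\frac{(p_0-q_0)^2}{(p_0\vee q_0)\{1-(p_0\wedge q_0)\}}.$$ On one probability space with probability measure $\mathbb P$, let $\mathcal A=\mathcal A^{(n)}=(a_{ij})$ be, for each $n$, the adjacency matrix of a random undirected network on $n$ nodes without self-loops, whose edge indicators $a_{ij}$, $i<j$, are independent Bernoulli variables with parameter $p_0$ if $z_{0i}=z_{0j}$ and $q_0$ otherwise; the joint law over different $n$ is arbitrary. The posterior is $\Pi(z\mid\mathcal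 A)\propto \mathcal L(\mathcal A\mid z)\,\Pi(z)$ on $\mathcal Z_{n,K}$, where $$\mathcal L(\mathcal A\mid z)=\int_0^1\!\!\int_0^1\prod_{i<j}\theta_{ij}^{a_{ij}}(1-\theta_{ij})^{1-a_{ij}}\,dq\,dp,\qquad \theta_{ij}=\begin{cases}p,&z_i=z_j,\\ q,&z_i\ne z_j,\end{cases}$$ and $E[d(z,z_0)\mid\mathcal A]=\sum_z d(z,z_0)\,\Pi(z\mid\mathcal A)$. Suppose that there are constants $C,C'>0$ and $\nu>1$, not depending on $n$, such that for all sufficiently large $n$ (multiples of $K$) $$\mathbb P\Big(E[d(z,z_0)\mid\mathcal A]\le \exp\Big\{-\frac{C\,n\,\bar D(p_0,q_0)}{K}\Big\}\Big)\ \ge\ 1-e^{-C'(\log n)^{\nu}}.$$ Then, $\mathbb P$-almost surely, for all sufficiently large $n$ (multiples of $K$), with the same constant $C$, $$\Pi\big[\langle z\rangle=\langle z_0\rangle\,\big|\,\mathcal A\big]\ \ge\ 1-\exp\Big\{-\frac{C\,n\,\bar D(p_0,q_0)}{K}\Big\}.$$ -/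

import Mathlib

open MeasureTheory ProbabilityTheory Filter

noncomputable section

namespace SBM

/-- Community assignments of `n` nodes into `K` communities. -/
abbrev Assignment (n K : ℕ) : Type := Fin n → Fin K

/-- The equivalence class of `z`: all relabelings `δ ∘ z`, with `δ` a permutation of the
community labels. -/
def labelClass {n K : ℕ} (z : Assignment n K) : Set (Assignment n K) :=
  Set.range fun δ : Equiv.Perm (Fin K) => (δ ∘ z : Assignment n K)

/-- The permutation-invariant Hamming distance `d(z, z') = inf_δ d_H(δ ∘ z, z')`. -/
def permDist {n K : ℕ} (z z' : Assignment n K) : ℕ :=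
  ⨅ δ : Equiv.Perm (Fin K), hammingDist (δ ∘ z : Assignment n K) z'

/-- Edge probability between the nodes `i` and `j` in a homogeneous stochastic block model. -/
def edgeProb {n K : ℕ} (z : Assignment n K) (p q : ℝ) (i j : Fin n) : ℝ :=
  if z i = z j then p else q

open Classical in
/-- The likelihood `∏_{i<j} θ_ij^{a_ij} (1 - θ_ij)^{1 - a_ij}` of a homogeneous stochastic block
model. An undirected network without self-loops is a simple graph on the nodes, and `a_ij`
indicates whether the nodes `i` and `j` are adjacent. -/
def likelihood {n K : ℕ} (G : SimpleGraph (Fin n)) (z : Assignment n K) (p q : ℝ) : ℝ :=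
  ∏ e : {e : Fin n × Fin n // e.1 < e.2},
    if G.Adj e.1.1 e.1.2 then edgeProb z p q e.1.1 e.1.2 else 1 - edgeProb z p q e.1.1 e.1.2

/-- The marginal likelihood of `z`: the likelihood integrated over independent uniform priors on
`(0, 1)` for the within- and between-community edge probabilities. -/
def marginalLikelihood {n K : ℕ} (G : SimpleGraph (Fin n)) (z : Assignment n K) : ℝ :=
  ∫ p in (0 : ℝ)..1, ∫ q in (0 : ℝ)..1, likelihood G z p q

/-- The posterior probability of the assignment `z` given the network `G`, under the prior `π`. -/
def posterior {n K : ℕ} (π : PMF (Assignment n K)) (G : SimpleGraph (Fin n))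
    (z : Assignment n K) : ℝ :=
  marginalLikelihood G z * (π z).toReal / ∑ z', marginalLikelihood G z' * (π z').toReal

open Classical in
/-- The posterior probability of a set of assignments. -/
def posteriorProb {n K : ℕ} (π : PMF (Assignment n K)) (G : SimpleGraph (Fin n))
    (S : Set (Assignment n K)) : ℝ :=
  ∑ z, if z ∈ S then posterior π G z else 0

/-- The posterior expected loss `E[d(z, z₀) | G]`. -/
def posteriorLoss {n K : ℕ} (π : PMF (Assignment n K)) (G : SimpleGraph (Fin n))
    (z₀ : Assignment n K) : ℝ :=
  ∑ z, (permDist z z₀ : ℝ) * posterior π G z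

/-- The signal strength `(p - q)² / ((p ∨ q) (1 - p ∧ q))`. -/
def Dbar (p q : ℝ) : ℝ :=
  (p - q) ^ 2 / (max p q * (1 - min p q))

/-- The random network `A` on `n` nodes follows the homogeneous stochastic block model with
assignment `z₀` and edge probabilities `p₀` (within) and `q₀` (between): the edge indicators of the
pairs `i < j` are independent Bernoulli random variables with the prescribed parameters. -/
structure IsHomogeneousSBM {Ω : Type*} [MeasurableSpace Ω] (P : Measure Ω) {n K : ℕ}
    (A : Ω → SimpleGraph (Fin n)) (z₀ : Assignment n K) (p₀ q₀ : ℝ) : Prop where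
  measurableSet_adj : ∀ i j : Fin n, i < j → MeasurableSet {ω | (A ω).Adj i j}
  prob_adj : ∀ i j : Fin n, i < j → P.real {ω | (A ω).Adj i j} = edgeProb z₀ p₀ q₀ i j
  indep : iIndepSet (fun e : {e : Fin n × Fin n // e.1 < e.2} =>
    {ω | (A ω).Adj e.1.1 e.1.2}) P

end SBM

end

/-!
The distance `permDist z z₀` is a natural number that vanishes only when `z` is a relabeling of
`z₀`, so Markov's inequality bounds the posterior probability of `⟨z⟩ ≠ ⟨z₀⟩` by the posterior
expected loss (`SBM.one_sub_posteriorLoss_le`). This uses that the posterior has total mass one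
(`SBM.sum_posterior`), that is, that the normalizing constant is nonzero: for `p` and `q` in the
open unit interval every likelihood is positive, hence so is every marginal likelihood
(`SBM.marginalLikelihood_pos`).

The risk bound fails with probability at most `exp (-C' (log n) ^ ν)`. As `ν > 1`, this is
eventually below `n⁻²`, hence summable (`summable_exp_neg_mul_log_rpow`), and by the first
Borel-Cantelli lemma the risk bound almost surely holds for all large `n`, whatever the joint law of
the networks.
-/

namespace SBM

variable {n K : ℕ}

lemma continuous_likelihood (G : SimpleGraph (Fin n)) (z : Assignment n K) :
    Continuous fun x : ℝ × ℝ => likelihood G z x.1 x.2 := by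
  unfold likelihood edgeProb
  refine continuous_finsetProd _ fun e _ => ?_
  split_ifs <;> fun_prop

lemma likelihood_pos (G : SimpleGraph (Fin n)) (z : Assignment n K) {p q : ℝ}
    (hp : p ∈ Set.Ioo (0 : ℝ) 1) (hq : q ∈ Set.Ioo (0 : ℝ) 1) : 0 < likelihood G z p q := by
  obtain ⟨hp0, hp1⟩ := hp
  obtain ⟨hq0, hq1⟩ := hq
  unfold likelihood edgeProb
  refine Finset.prod_pos fun e _ => ?_
  split_ifs <;> linarith

lemma marginalLikelihood_pos (G : SimpleGraph (Fin n)) (z : Assignment n K) :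
    0 < marginalLikelihood G z := by
  have hcont := continuous_likelihood G z
  refine intervalIntegral.intervalIntegral_pos_of_pos_on
    (Continuous.intervalIntegrable ?_ _ _) (fun p hp => ?_) one_pos
  · exact intervalIntegral.continuous_parametric_intervalIntegral_of_continuous' hcont 0 1
  · exact intervalIntegral.intervalIntegral_pos_of_pos_on
      ((hcont.comp (Continuous.prodMk_right p)).intervalIntegrable _ _)
      (fun q hq => likelihood_pos G z hp hq) one_pos

lemma posterior_nonneg (π : PMF (Assignment n K)) (G : SimpleGraph (Fin n))
    (z : Assignment n K) : 0 ≤ posterior π G z :=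
  div_nonneg (mul_nonneg (marginalLikelihood_pos G z).le ENNReal.toReal_nonneg)
    (Finset.sum_nonneg fun z' _ =>
      mul_nonneg (marginalLikelihood_pos G z').le ENNReal.toReal_nonneg)

lemma sum_posterior (π : PMF (Assignment n K)) (G : SimpleGraph (Fin n)) :
    ∑ z, posterior π G z = 1 := by
  obtain ⟨z, hz⟩ := π.support_nonempty
  have hpos : 0 < ∑ z', marginalLikelihood G z' * (π z').toReal :=
    Finset.sum_pos'
      (fun z' _ => mul_nonneg (marginalLikelihood_pos G z').le ENNReal.toReal_nonneg)
      ⟨z, Finset.mem_univ z, mul_pos (marginalLikelihood_pos G z)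
        (ENNReal.toReal_pos ((π.mem_support_iff z).1 hz) (π.apply_ne_top z))⟩
  unfold posterior
  rw [← Finset.sum_div, div_self hpos.ne']

lemma labelClass_comp (δ : Equiv.Perm (Fin K)) (z : Assignment n K) :
    labelClass (δ ∘ z : Assignment n K) = labelClass z :=
  (Equiv.mulRight δ).surjective.range_comp
    fun σ : Equiv.Perm (Fin K) => (σ ∘ z : Assignment n K)

lemma labelClass_eq_of_permDist_eq_zero {z z' : Assignment n K} (h : permDist z z' = 0) :
    labelClass z = labelClass z' := by
  obtain ⟨δ, hδ⟩ : permDist z z' ∈ Set.range fun δ : Equiv.Perm (Fin K) =>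
    hammingDist (δ ∘ z : Assignment n K) z' := Nat.sInf_mem (Set.range_nonempty _)
  rw [← hammingDist_eq_zero.1 (hδ.trans h), labelClass_comp]

/-- Markov's inequality for the posterior: `permDist z z₀ ≥ 1` off the class of `z₀`. -/
lemma one_sub_posteriorLoss_le (π : PMF (Assignment n K)) (G : SimpleGraph (Fin n))
    (z₀ : Assignment n K) :
    1 - posteriorLoss π G z₀ ≤ posteriorProb π G {z | labelClass z = labelClass z₀} := by
  classical
  rw [← sum_posterior π G, posteriorLoss, posteriorProb, ← Finset.sum_sub_distrib]
  refine Finset.sum_le_sum fun z _ => ?_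
  have hnonneg := posterior_nonneg π G z
  split_ifs with hz
  · exact sub_le_self _ (by positivity)
  · have hdist : (1 : ℝ) ≤ permDist z z₀ :=
      Nat.one_le_cast.2 (Nat.one_le_iff_ne_zero.2 fun h => hz
        (labelClass_eq_of_permDist_eq_zero h))
    linarith [le_mul_of_one_le_left hnonneg hdist]

/-- Every event about the network is measurable, as it is determined by finitely many edge
indicators. -/
lemma IsHomogeneousSBM.measurableSet_setOf {Ω : Type*} [MeasurableSpace Ω] {P : Measure Ω}
    {A : Ω → SimpleGraph (Fin n)} {z₀ : Assignment n K} {p₀ q₀ : ℝ}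
    (hA : IsHomogeneousSBM P A z₀ p₀ q₀) (p : SimpleGraph (Fin n) → Prop) :
    MeasurableSet {ω | p (A ω)} := by
  have hadj : ∀ i j, MeasurableSet {ω | (A ω).Adj i j} := by
    intro i j
    rcases lt_trichotomy i j with h | rfl | h
    · exact hA.measurableSet_adj i j h
    · simp
    · simpa only [SimpleGraph.adj_comm] using hA.measurableSet_adj j i h
  have hfiber : ∀ G, MeasurableSet {ω | A ω = G} := by
    intro G
    have : {ω | A ω = G} = ⋂ i, ⋂ j, {ω | (A ω).Adj i j ↔ G.Adj i j} := by
      ext ω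
      simp [SimpleGraph.ext_iff, funext_iff]
    rw [this]
    exact .iInter fun i => .iInter fun j => (hadj i j).iff (.const _)
  have : {ω | p (A ω)} = ⋃ G, ⋃ _ : p G, {ω | A ω = G} := by
    ext ω
    simp
  rw [this]
  exact .iUnion fun G => .iUnion fun _ => hfiber G

end SBM

lemma summable_exp_neg_mul_log_rpow {c ν : ℝ} (hc : 0 < c) (hν : 1 < ν) :
    Summable fun n : ℕ => Real.exp (-c * Real.log n ^ ν) := by
  have hlog : Tendsto (fun n : ℕ => Real.log n) atTop atTop :=
    Real.tendsto_log_atTop.comp tendsto_natCast_atTop_atTop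
  have hpow : ∀ᶠ n : ℕ in atTop, 2 ≤ c * Real.log n ^ (ν - 1) :=
    (((tendsto_rpow_atTop (sub_pos.2 hν)).comp hlog).const_mul_atTop hc).eventually_ge_atTop 2
  refine .of_norm_bounded_eventually_nat (Real.summable_nat_pow_inv.2 one_lt_two) ?_
  filter_upwards [hpow, hlog.eventually_gt_atTop 0, eventually_gt_atTop 0] with n hn hl hn0
  have hsplit : Real.log n ^ ν = Real.log n ^ (ν - 1) * Real.log n := by
    rw [← Real.rpow_add_one hl.ne', sub_add_cancel]
  have hexp : ((n : ℝ) ^ 2)⁻¹ = Real.exp (-(2 * Real.log n)) := by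
    rw [Real.exp_neg, two_mul, Real.exp_add, Real.exp_log (by positivity), sq]
  rw [Real.norm_of_nonneg (Real.exp_nonneg _), hexp, Real.exp_le_exp, hsplit]
  linarith [mul_le_mul_of_nonneg_right hn hl.le]

theorem corollary4p2
    {Ω : Type*} [MeasurableSpace Ω] (P : Measure Ω) [IsProbabilityMeasure P]
    -- the known number of communities; the number `n` of nodes ranges over its multiples
    (K : ℕ) (hK : 1 ≤ K)
    -- true assignments and true edge probabilities, which may vary with `n`
    (z₀ : (n : ℕ) → SBM.Assignment n K)
    (p₀ q₀ : ℕ → ℝ)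
    (hp₀ : ∀ n, p₀ n ∈ Set.Icc (0 : ℝ) 1) (hq₀ : ∀ n, q₀ n ∈ Set.Icc (0 : ℝ) 1)
    (hpq : ∀ n, p₀ n ≠ q₀ n)
    -- prior distributions on the assignments
    (π : (n : ℕ) → PMF (SBM.Assignment n K))
    -- the observed networks, on a common probability space with an arbitrary joint law
    (A : (n : ℕ) → Ω → SimpleGraph (Fin n))
    (hA : ∀ n, K ∣ n → SBM.IsHomogeneousSBM P (A n) (z₀ n) (p₀ n) (q₀ n))
    -- the assumed posterior risk bound, with high probability
    (C C' ν : ℝ) (hC : 0 < C) (hC' : 0 < C') (hν : 1 < ν)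
    (hrisk : ∀ᶠ n : ℕ in atTop, K ∣ n →
      1 - Real.exp (-C' * Real.log n ^ ν) ≤
        P.real {ω | SBM.posteriorLoss (π n) (A n ω) (z₀ n) ≤
          Real.exp (-(C * n * SBM.Dbar (p₀ n) (q₀ n) / K))}) :
    ∀ᵐ ω ∂P, ∀ᶠ n : ℕ in atTop, K ∣ n →
      1 - Real.exp (-(C * n * SBM.Dbar (p₀ n) (q₀ n) / K)) ≤
        SBM.posteriorProb (π n) (A n ω)
          {z | SBM.labelClass z = SBM.labelClass (z₀ n)} := by
  set F : ℕ → Set Ω := fun n => {ω | K ∣ n ∧ ¬ SBM.posteriorLoss (π n) (A n ω) (z₀ n) ≤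
    Real.exp (-(C * n * SBM.Dbar (p₀ n) (q₀ n) / K))} with hF
  have hbound : ∀ᶠ n : ℕ in atTop, ‖P.real (F n)‖ ≤ Real.exp (-C' * Real.log n ^ ν) := by
    filter_upwards [hrisk] with n hn
    rw [Real.norm_of_nonneg measureReal_nonneg]
    by_cases hd : K ∣ n
    · have hmeas := (hA n hd).measurableSet_setOf fun G =>
        SBM.posteriorLoss (π n) G (z₀ n) ≤ Real.exp (-(C * n * SBM.Dbar (p₀ n) (q₀ n) / K))
      have hcompl : F n = {ω | SBM.posteriorLoss (π n) (A n ω) (z₀ n) ≤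
          Real.exp (-(C * n * SBM.Dbar (p₀ n) (q₀ n) / K))}ᶜ := by
        ext ω
        simp [hF, hd]
      rw [hcompl, probReal_compl_eq_one_sub hmeas]
      linarith [hn hd]
    · simp [hF, hd, Real.exp_nonneg]
  have hsum : Summable fun n => P.real (F n) :=
    .of_norm_bounded_eventually_nat (summable_exp_neg_mul_log_rpow hC' hν) hbound
  have hfin : ∑' n, P (F n) ≠ ⊤ := by
    simpa [Measure.real, ENNReal.ofReal_toReal] using hsum.tsum_ofReal_ne_top
  filter_upwards [ae_eventually_notMem hfin] with ω hω
  filter_upwards [hω] with n hn hd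
  have hloss : SBM.posteriorLoss (π n) (A n ω) (z₀ n) ≤
      Real.exp (-(C * n * SBM.Dbar (p₀ n) (q₀ n) / K)) := by
    by_contra h
    exact hn ⟨hd, h⟩
  linarith [SBM.one_sub_posteriorLoss_le (π n) (A n ω) (z₀ n)]
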